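/- For $x\in\mathbb{R}^N$ and an integer $1\le k\le N$, let $x_k$ denote a best $k$-sparse approximation of $x$ in the Euclidean norm. A *randomized sparse recovery algorithm with $m$ measurements* is a probability distribution on $m\times N$ real matrices $\Phi$ together with a (Borel measurable) decoder $A$, which knows $\Phi$ and is given $y=\Phi x$; its output on $x$ is $A(\Phi,\Phi x)\in\mathbb{R}^N$. It meets the $\ell_2/\ell_2$ guarantee on $x$ with factor $C$ if $\|x-A(\Phi,\Phi x)\|_2\le C\,\|x-x_k\|_2$. An *$s$-information-theoretically bounded adversary* is a map $M$ that sees the matrix $\Phi$, outputs a signal $M(\Phi)\in\mathbb{R}^N$ and factors as $M(\Phi)=M_2(M_1(\Phi))$, where the output of $M_1$ is a bit string of length at most $s$. **Corollary.** There are absolute constants $C,K>0$ and, for every $0<\alpha<1$, a constant $K_\alpha>0$ such that the following holds for all $0<\alpha<1$ and all integers $1\le k\le N$ and $s\ge 0$. There is a randomized sparse recovery algorithm with $$m\le K_\alpha\Big(k\,\max\{1,\log(N/k)\}+\frac{s}{\alpha}\Big)$$ measurements such that, for every $s$-information-theoretically bounded adversary $M$, with probability at least $1-\alpha$ over $\Phi$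 the output of the algorithm on the signal $x=M(\Phi)$ meets the $\ell_2/\ell_2$ guarantee with factor $C$. If moreover $s\ge 1$, then $m$ also satisfies the bound $m\le K\big(k\max\{1,\log(N/k)\}+s/\alpha\big)$, with the constant $K$ that does not depend on $\alpha$. -/

import Mathlib

open MeasureTheory

/-- `z` has at most `k` non-zero coordinates. -/
def IsSparse {N : ℕ} (k : ℕ) (z : EuclideanSpace ℝ (Fin N)) : Prop :=
  {i | z i ≠ 0}.ncard ≤ k

/-- `z` is a best `k`-sparse approximation of `x` in the Euclidean norm. -/
def IsBestSparseApprox {N : ℕ} (k : ℕ) (x z : EuclideanSpace ℝ (Fin N)) : Prop :=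
  IsSparse k z ∧ ∀ w : EuclideanSpace ℝ (Fin N), IsSparse k w → ‖x - z‖ ≤ ‖x - w‖

/-- A best `k`-sparse approximation always exists. -/
theorem exists_isBestSparseApprox {N : ℕ} (k : ℕ) (x : EuclideanSpace ℝ (Fin N)) :
    ∃ z, IsBestSparseApprox k x z := by
  classical
  let r : Finset (Fin N) → EuclideanSpace ℝ (Fin N) := fun S =>
    WithLp.toLp 2 (fun i => if i ∈ S then x i else 0)
  obtain ⟨S, hS, hmin⟩ := Finset.exists_min_image
    (Finset.univ.filter fun S : Finset (Fin N) => S.card ≤ k) (fun S => ‖x - r S‖)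
    ⟨∅, by simp⟩
  refine ⟨r S, ?_, fun w hw => ?_⟩
  · refine le_trans ?_ (Finset.mem_filter.1 hS).2
    rw [← Set.ncard_coe_finset S]
    refine Set.ncard_le_ncard (fun i hi => ?_) S.finite_toSet
    by_contra h
    exact hi (if_neg (by simpa using h))
  · have hT : (Finset.univ.filter fun i => w i ≠ 0).card ≤ k := by
      rw [← Set.ncard_coe_finset]
      simpa [IsSparse] using hw
    refine (hmin (Finset.univ.filter fun i => w i ≠ 0) (by simpa using hT)).trans ?_
    rw [EuclideanSpace.norm_eq, EuclideanSpace.norm_eq]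
    refine Real.sqrt_le_sqrt (Finset.sum_le_sum fun i _ => ?_)
    by_cases h : w i = 0
    · simp [r, h]
    · simp [r, h, sq_nonneg]

/-- The `ℓ₂/ℓ₂` error guarantee for sparsity `k` with approximation factor `C`: the output `xhat`
satisfies `‖x - xhat‖₂ ≤ C ‖x - x_k‖₂`, where `x_k` is a best `k`-sparse approximation of `x`. -/
def MeetsL2L2 {N : ℕ} (k : ℕ) (C : ℝ) (x xhat : EuclideanSpace ℝ (Fin N)) : Prop :=
  ∀ xk, IsBestSparseApprox k x xk → ‖x - xhat‖ ≤ C * ‖x - xk‖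

/-- Matrices carry the product (Borel) `σ`-algebra of their entries. -/
instance matrixMeasurableSpace (m N : ℕ) : MeasurableSpace (Matrix (Fin m) (Fin N) ℝ) :=
  inferInstanceAs (MeasurableSpace (Fin m → Fin N → ℝ))

/-- A randomized sparse recovery algorithm with `m` measurements for signals in `ℝ^N`:
a probability distribution on `m × N` measurement matrices together with a (Borel measurable)
decoder, which knows the matrix `Φ` and is given the measurement vector `y = Φ x`. -/
structure RandomizedRecovery (m N : ℕ) where
  law : Measure (Matrix (Fin m) (Fin N) ℝ)
  isProbabilityMeasure : IsProbabilityMeasure law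
  decode : Matrix (Fin m) (Fin N) ℝ → (Fin m → ℝ) → EuclideanSpace ℝ (Fin N)
  measurable_decode :
    Measurable fun p : Matrix (Fin m) (Fin N) ℝ × (Fin m → ℝ) => decode p.1 p.2

/-- The output of the recovery algorithm when the random matrix is `Φ` and the signal is `x`. -/
def RandomizedRecovery.output {m N : ℕ} (R : RandomizedRecovery m N)
    (Φ : Matrix (Fin m) (Fin N) ℝ) (x : EuclideanSpace ℝ (Fin N)) : EuclideanSpace ℝ (Fin N) :=
  R.decode Φ (Matrix.mulVec Φ x.ofLp)

/-- `M` is `s`-information-theoretically bounded: `M = M₂ ∘ M₁`, where the output of `M₁` is a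
bit string of length at most `s`. -/
def IsInfoBounded {X Y : Type*} (s : ℕ) (M : X → Y) : Prop :=
  ∃ (M₁ : X → List Bool) (M₂ : List Bool → Y), (∀ r, (M₁ r).length ≤ s) ∧ ∀ r, M r = M₂ (M₁ r)

/-- The algorithm `R` meets the `ℓ₂/ℓ₂` guarantee with probability at least `1 - α` against every
`s`-information-theoretically bounded adversary `M`, which sees the matrix `Φ` and outputs the
signal `M Φ`. The set of matrices on which the guarantee fails has (outer) measure at most `α`;
no measurability of the adversary is needed. -/
def RandomizedRecovery.Foils {m N : ℕ} (R : RandomizedRecovery m N)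
    (k s : ℕ) (C α : ℝ) : Prop :=
  ∀ M : Matrix (Fin m) (Fin N) ℝ → EuclideanSpace ℝ (Fin N), IsInfoBounded s M →
    R.law {Φ | ¬ MeetsL2L2 k C (M Φ) (R.output Φ (M Φ))} ≤ ENNReal.ofReal α

/-! Take a matrix with independent standard Gaussian entries and decode by a `k`-sparse vector of
smallest residual. Two properties of `Φ` suffice for recovery. The first, `IsBoundedBelow`, is
uniform: `‖Φ v‖ ≥ √m ‖v‖ / 10` on all differences of `k`-sparse vectors. It does not involve the
adversary, and a net argument with a union bound over supports gives it once `m` is of order `k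
max(1, log (N/k))`. The second concerns only the signal in play: `‖Φ (x - x_k)‖ ≤ 2 √m ‖x - x_k‖`.
For a fixed `x` it fails with probability at most `exp (-m/4)`.

The adversary sees `Φ`, but its signal is one of fewer than `2 ^ (s + 1)` vectors `M₂ b` fixed in
advance. A union bound over the strings `b` (`measure_exists_list_bool_le`) secures the second
property for all of them, at a cost of order `s + log (1/α)` measurements.

With `z` the decoded vector, `√m ‖x_k - z‖ / 10 ≤ ‖Φ (x_k - z)‖ ≤ 2 ‖Φ (x - x_k)‖ ≤ 4 √m ‖x - x_k‖`,
hence the factor 41 (`IsBoundedBelow.norm_sub_le`). The decoder must be Borel, so it solves normal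
equations explicitly on each support and keeps the best (`exists_measurable_decoder`). -/

open ProbabilityTheory

/-! ### Concentration of the norm of a Gaussian image -/

/-- A linear functional of a standard Gaussian vector given by a unit vector is standard
Gaussian. -/
theorem map_dotProduct_pi_gaussianReal {N : ℕ} (v : EuclideanSpace ℝ (Fin N)) (hv : ‖v‖ = 1) :
    (Measure.pi (fun _ : Fin N => gaussianReal 0 1)).map (fun g => g ⬝ᵥ v.ofLp)
      = gaussianReal 0 1 := by
  have hm : Measurable fun g : Fin N → ℝ => g ⬝ᵥ v.ofLp := by
    unfold dotProduct; fun_prop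
  have := Measure.isProbabilityMeasure_map (μ := Measure.pi (fun _ : Fin N => gaussianReal 0 1))
    hm.aemeasurable
  -- The characteristic function factors over the coordinates into `exp (-t² ∑ v_j² / 2)`, and `∑
  -- v_j² = 1`.
  apply Measure.ext_of_charFun
  ext t
  rw [charFun_apply_real, integral_map hm.aemeasurable (by fun_prop)]
  have h1 : ∀ g : Fin N → ℝ, Complex.exp (t * (g ⬝ᵥ v.ofLp : ℝ) * Complex.I)
      = ∏ j, Complex.exp ((t * v j : ℝ) * g j * Complex.I) := by
    intro g
    rw [← Complex.exp_sum, dotProduct]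
    congr 1
    push_cast
    rw [Finset.mul_sum, Finset.sum_mul]
    exact Finset.sum_congr rfl fun j _ => by ring
  simp_rw [h1]
  rw [integral_fintype_prod_eq_prod
    (f := fun j x => Complex.exp ((t * v j : ℝ) * (x : ℝ) * Complex.I))]
  simp_rw [← charFun_apply_real, charFun_gaussianReal]
  rw [← Complex.exp_sum]
  congr 1
  have h2 : ∑ j, (v j) ^ 2 = 1 := by
    rw [← EuclideanSpace.real_norm_sq_eq, hv]; norm_num
  have h3 : ∑ j, ((v j : ℝ) : ℂ) ^ 2 = 1 := by exact_mod_cast h2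
  simp only [Complex.ofReal_zero, mul_zero, zero_mul, NNReal.coe_one, Complex.ofReal_one, one_mul,
    zero_sub, Complex.ofReal_mul, mul_pow]
  rw [Finset.sum_neg_distrib, ← Finset.sum_div, ← Finset.mul_sum, h3, mul_one]

theorem exp_mul_sq_mul_gaussianPDFReal (t x : ℝ) :
    gaussianPDFReal 0 1 x * Real.exp (t * x ^ 2)
      = (√(2 * Real.pi))⁻¹ * Real.exp (-(1 / 2 - t) * x ^ 2) := by
  rw [gaussianPDFReal, mul_assoc, ← Real.exp_add]
  simp only [NNReal.coe_one, mul_one, sub_zero]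
  congr 2
  ring

theorem integrable_exp_mul_sq_gaussianReal {t : ℝ} (ht : t < 1 / 2) :
    Integrable (fun x : ℝ => Real.exp (t * x ^ 2)) (gaussianReal 0 1) := by
  rw [gaussianReal_of_var_ne_zero _ one_ne_zero,
    integrable_withDensity_iff (measurable_gaussianPDF 0 1)
      (Filter.Eventually.of_forall fun _ => gaussianPDF_lt_top)]
  simp_rw [toReal_gaussianPDF, fun x => mul_comm (Real.exp (t * x ^ 2)),
    exp_mul_sq_mul_gaussianPDFReal]
  exact (integrable_exp_neg_mul_sq (by linarith)).const_mul _

theorem integral_exp_mul_sq_gaussianReal {t : ℝ} (ht : t < 1 / 2) :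
    ∫ x, Real.exp (t * x ^ 2) ∂gaussianReal 0 1 = (√(1 - 2 * t))⁻¹ := by
  rw [integral_gaussianReal_eq_integral_smul one_ne_zero]
  simp_rw [smul_eq_mul, exp_mul_sq_mul_gaussianPDFReal]
  rw [integral_const_mul, integral_gaussian, ← Real.sqrt_inv, ← Real.sqrt_inv,
    ← Real.sqrt_mul (by positivity)]
  congr 1
  have : (1 : ℝ) / 2 - t ≠ 0 := by linarith
  have : (1 : ℝ) - 2 * t ≠ 0 := by linarith
  field_simp

/-- The law of an `m × N` matrix with independent standard Gaussian entries. -/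
noncomputable def gaussianMatrix (m N : ℕ) : Measure (Matrix (Fin m) (Fin N) ℝ) :=
  (Measure.pi fun _ : Fin m => Measure.pi fun _ : Fin N => gaussianReal 0 1 :
    Measure (Fin m → Fin N → ℝ))

instance isProbabilityMeasure_gaussianMatrix (m N : ℕ) :
    IsProbabilityMeasure (gaussianMatrix m N) :=
  inferInstanceAs (IsProbabilityMeasure
    (Measure.pi fun _ : Fin m => Measure.pi fun _ : Fin N => gaussianReal 0 1))

theorem norm_toEuclideanLin_sq {m N : ℕ} (Φ : Matrix (Fin m) (Fin N) ℝ)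
    (v : EuclideanSpace ℝ (Fin N)) :
    ‖Matrix.toEuclideanLin Φ v‖ ^ 2 = ∑ i, (Φ i ⬝ᵥ v.ofLp) ^ 2 := by
  rw [EuclideanSpace.real_norm_sq_eq]
  rfl

/-- The rows are independent and each contributes the square of a standard Gaussian, so the moment
is the `m`-th power of the one-dimensional one. Markov's inequality needs integrability as well as
the value. -/
theorem integrable_integral_exp_norm_sq {m N : ℕ} (v : EuclideanSpace ℝ (Fin N)) (hv : ‖v‖ = 1)
    {t : ℝ} (ht : t < 1 / 2) :
    Integrable (fun Φ => Real.exp (t * ‖Matrix.toEuclideanLin Φ v‖ ^ 2)) (gaussianMatrix m N) ∧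
    ∫ Φ, Real.exp (t * ‖Matrix.toEuclideanLin Φ v‖ ^ 2) ∂gaussianMatrix m N
      = (√(1 - 2 * t))⁻¹ ^ m := by
  have hm : Measurable fun g : Fin N → ℝ => g ⬝ᵥ v.ofLp := by
    unfold dotProduct; fun_prop
  have h1 : ∀ Φ : Matrix (Fin m) (Fin N) ℝ, Real.exp (t * ‖Matrix.toEuclideanLin Φ v‖ ^ 2)
      = ∏ i, Real.exp (t * (Φ i ⬝ᵥ v.ofLp) ^ 2) := by
    intro Φ
    rw [norm_toEuclideanLin_sq, Finset.mul_sum, Real.exp_sum]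
  simp_rw [h1]
  have hmap := map_dotProduct_pi_gaussianReal v hv
  constructor
  · refine Integrable.fintype_prod (f := fun _ g => Real.exp (t * (g ⬝ᵥ v.ofLp) ^ 2))
      (μ := fun _ : Fin m => Measure.pi fun _ : Fin N => gaussianReal 0 1) fun i => ?_
    have := integrable_exp_mul_sq_gaussianReal ht
    rw [← hmap] at this
    exact this.comp_measurable hm
  · refine (integral_fintype_prod_eq_prod (ι := Fin m) (E := fun _ => Fin N → ℝ)
      (f := fun _ g => Real.exp (t * (g ⬝ᵥ v.ofLp) ^ 2))
      (μ := fun _ => Measure.pi fun _ : Fin N => gaussianReal 0 1)).trans ?_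
    rw [Finset.prod_const, Finset.card_univ, Fintype.card_fin]
    congr 1
    rw [← integral_map (φ := fun g : Fin N → ℝ => g ⬝ᵥ v.ofLp)
      (f := fun x : ℝ => Real.exp (t * x ^ 2)) hm.aemeasurable (by fun_prop), hmap,
      integral_exp_mul_sq_gaussianReal ht]

/-- Markov's inequality for the exponential moments of `‖Φ v‖²`. -/
theorem gaussianMatrix_chernoff {m N : ℕ} (v : EuclideanSpace ℝ (Fin N)) (hv : ‖v‖ = 1)
    {t c r : ℝ} (ht : t < 1 / 2) (hr : (√(1 - 2 * t))⁻¹ ≤ Real.exp (c - r)) :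
    gaussianMatrix m N {Φ | c * m ≤ t * ‖Matrix.toEuclideanLin Φ v‖ ^ 2}
      ≤ ENNReal.ofReal (Real.exp (-(r * m))) := by
  obtain ⟨hi, he⟩ := integrable_integral_exp_norm_sq (m := m) v hv ht
  have h := mul_meas_ge_le_integral_of_nonneg (μ := gaussianMatrix m N)
    (Filter.Eventually.of_forall fun Φ => (Real.exp_pos _).le) hi (Real.exp (c * m))
  rw [he] at h
  have h2 : (√(1 - 2 * t))⁻¹ ^ m ≤ Real.exp (c * m) * Real.exp (-(r * m)) := by
    rw [← Real.exp_add]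
    calc _ ≤ Real.exp (c - r) ^ m := pow_le_pow_left₀ (by positivity) hr m
      _ = _ := by rw [← Real.exp_nat_mul]; congr 1; ring
  have h3 := le_of_mul_le_mul_left (h.trans h2) (Real.exp_pos _)
  simp_rw [Real.exp_le_exp] at h3
  exact (ENNReal.le_ofReal_iff_toReal_le (measure_ne_top _ _) (Real.exp_pos _).le).2 h3

theorem gaussianMatrix_norm_gt {m N : ℕ} (v : EuclideanSpace ℝ (Fin N)) :
    gaussianMatrix m N {Φ | 2 * √m * ‖v‖ < ‖Matrix.toEuclideanLin Φ v‖}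
      ≤ ENNReal.ofReal (Real.exp (-(m / 4))) := by
  rcases eq_or_ne v 0 with rfl | hv
  · simp
  have hv' : 0 < ‖v‖ := norm_pos_iff.2 hv
  have hu : ‖‖v‖⁻¹ • v‖ = 1 := by rw [norm_smul, norm_inv, norm_norm, inv_mul_cancel₀ hv'.ne']
  -- The event is `‖Φ u‖² ≥ 4 m` for the unit vector `u`; the rate `1/4` amounts to `√2 ≤ exp
  -- (3/4)`.
  have key := gaussianMatrix_chernoff (m := m) (‖v‖⁻¹ • v) hu (t := 1 / 4) (c := 1) (r := 1 / 4)
    (by norm_num) (by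
      have h1 : (1 : ℝ) - 2 * (1 / 4) = 1 / 2 := by norm_num
      rw [h1, ← Real.sqrt_inv, show (1 : ℝ) - 1 / 4 = 3 / 4 by norm_num]
      refine Real.sqrt_le_iff.2 ⟨(Real.exp_pos _).le, ?_⟩
      rw [← Real.exp_nat_mul]
      have := Real.add_one_le_exp (((2 : ℕ) : ℝ) * (3 / 4))
      push_cast at *
      linarith)
  rw [show (1 : ℝ) / 4 * m = m / 4 by ring] at key
  refine (measure_mono fun Φ hΦ => ?_).trans key
  simp only [Set.mem_ofPred_eq, map_smul, norm_smul, norm_inv, norm_norm] at hΦ ⊢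
  have h1 : 2 * √m < ‖v‖⁻¹ * ‖Matrix.toEuclideanLin Φ v‖ := by
    rw [inv_mul_eq_div, lt_div_iff₀ hv']; exact hΦ
  have h2 := pow_le_pow_left₀ (by positivity) h1.le 2
  rw [mul_pow, Real.sq_sqrt (Nat.cast_nonneg m)] at h2
  linarith

theorem gaussianMatrix_norm_lt {m N : ℕ} (v : EuclideanSpace ℝ (Fin N)) :
    gaussianMatrix m N {Φ | ‖Matrix.toEuclideanLin Φ v‖ < 1 / 2 * √m * ‖v‖}
      ≤ ENNReal.ofReal (Real.exp (-(m / 4))) := by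
  rcases eq_or_ne v 0 with rfl | hv
  · simp
  have hv' : 0 < ‖v‖ := norm_pos_iff.2 hv
  have hu : ‖‖v‖⁻¹ • v‖ = 1 := by rw [norm_smul, norm_inv, norm_norm, inv_mul_cancel₀ hv'.ne']
  -- A negative `t` turns Markov's inequality into a lower tail bound: the event is `‖Φ u‖² ≤ m /
  -- 4`, and the rate `1/4` amounts to `exp (5/8) ≤ 2`.
  have key := gaussianMatrix_chernoff (m := m) (‖v‖⁻¹ • v) hu (t := -(3 / 2)) (c := -(3 / 8))
    (r := 1 / 4) (by norm_num) (by
      have h1 : (1 : ℝ) - 2 * (-(3 / 2)) = 2 ^ 2 := by norm_num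
      rw [h1, Real.sqrt_sq (by norm_num), show -(3 / 8 : ℝ) - 1 / 4 = -(5 / 8) by norm_num,
        Real.exp_neg]
      refine inv_anti₀ (Real.exp_pos _) ?_
      rw [← Real.le_log_iff_exp_le (by norm_num)]
      have := Real.log_two_gt_d9
      linarith)
  rw [show (1 : ℝ) / 4 * m = m / 4 by ring] at key
  refine (measure_mono fun Φ hΦ => ?_).trans key
  simp only [Set.mem_ofPred_eq, map_smul, norm_smul, norm_inv, norm_norm] at hΦ ⊢
  have h1 : ‖v‖⁻¹ * ‖Matrix.toEuclideanLin Φ v‖ < 1 / 2 * √m := by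
    rw [inv_mul_eq_div, div_lt_iff₀ hv']; exact hΦ
  have h2 := pow_le_pow_left₀ (by positivity) h1.le 2
  rw [mul_pow (1 / 2 : ℝ), Real.sq_sqrt (Nat.cast_nonneg m)] at h2
  linarith

/-! ### Nets in finite-dimensional balls -/

section Net

variable {E : Type*} [NormedAddCommGroup E] [NormedSpace ℝ E] [FiniteDimensional ℝ E]

/-- A 1-separated set in the ball of radius 2 has at most `5 ^ dim` points by packing. One of
maximal cardinality comes within distance 1 of every point of that ball; halving it gives the net.
-/
theorem exists_half_net :
    ∃ T : Finset E, T.card ≤ 5 ^ Module.finrank ℝ E ∧ ∀ v : E, ‖v‖ ≤ 1 → ∃ w ∈ T, ‖v - w‖ ≤ 1 / 2 := by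
  classical
  let P : Finset E → Prop := fun s =>
    (∀ c ∈ s, ‖c‖ ≤ 2) ∧ ∀ c ∈ s, ∀ d ∈ s, c ≠ d → 1 ≤ ‖c - d‖
  have hP : ∀ s, P s → s.card ≤ 5 ^ Module.finrank ℝ E := fun s hs =>
    Besicovitch.card_le_of_separated s hs.1 hs.2
  obtain ⟨s, hs, hmax⟩ : ∃ s, P s ∧ ∀ s', P s' → s'.card ≤ s.card := by
    let Q : ℕ → Prop := fun n => ∃ s, P s ∧ s.card = n
    have h0 : Q 0 := ⟨∅, ⟨by simp, by simp⟩, rfl⟩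
    obtain ⟨s, hs, hc⟩ := Nat.findGreatest_spec (P := Q) (Nat.zero_le (5 ^ Module.finrank ℝ E)) h0
    exact ⟨s, hs, fun s' hs' => hc ▸ Nat.le_findGreatest (hP s' hs') ⟨s', hs', rfl⟩⟩
  refine ⟨s.image fun w => (1 / 2 : ℝ) • w, Finset.card_image_le.trans (hP s hs), fun v hv => ?_⟩
  by_contra! hfar
  have hfar' : ∀ c ∈ s, 1 < ‖(2 : ℝ) • v - c‖ := by
    intro c hc
    have h := hfar _ (Finset.mem_image_of_mem _ hc)
    have h2 : (2 : ℝ) • v - c = (2 : ℝ) • (v - (1 / 2 : ℝ) • c) := by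
      rw [smul_sub, smul_smul]; norm_num
    rw [h2, norm_smul, Real.norm_ofNat]
    linarith
  have hnot : (2 : ℝ) • v ∉ s := fun hmem => by
    have := hfar' _ hmem
    norm_num at this
  have hins : P (insert ((2 : ℝ) • v) s) := by
    refine ⟨fun c hc => ?_, fun c hc d hd hcd => ?_⟩
    · rcases Finset.mem_insert.1 hc with rfl | hc
      · rw [norm_smul, Real.norm_ofNat]; linarith
      · exact hs.1 c hc
    · rcases Finset.mem_insert.1 hc with rfl | hc <;> rcases Finset.mem_insert.1 hd with rfl | hd
      · exact absurd rfl hcd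
      · exact (hfar' d hd).le
      · rw [norm_sub_rev]; exact (hfar' c hc).le
      · exact hs.2 c hc d hd hcd
  have := hmax _ hins
  rw [Finset.card_insert_of_notMem hnot] at this
  omega

/-- The error left by the net at scale `2⁻ʲ` is blown up to the unit ball and approximated there by
the half-net, so each halving costs one more factor `5 ^ dim`. -/
theorem exists_pow_half_net (j : ℕ) :
    ∃ T : Finset E, T.card ≤ (5 ^ Module.finrank ℝ E) ^ j ∧
      ∀ v : E, ‖v‖ ≤ 1 → ∃ w ∈ T, ‖v - w‖ ≤ (1 / 2) ^ j := by
  classical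
  induction j with
  | zero => exact ⟨{0}, by simp, fun v hv => ⟨0, by simp, by simpa using hv⟩⟩
  | succ j ih =>
    obtain ⟨T, hT, hTn⟩ := ih
    obtain ⟨T₁, hT₁, hT₁n⟩ := exists_half_net (E := E)
    refine ⟨(T ×ˢ T₁).image fun p => p.1 + ((1 / 2 : ℝ) ^ j) • p.2, ?_, fun v hv => ?_⟩
    · refine Finset.card_image_le.trans ?_
      rw [Finset.card_product, pow_succ]
      exact Nat.mul_le_mul hT hT₁
    · obtain ⟨w, hw, hvw⟩ := hTn v hv
      obtain ⟨u, hu, hvu⟩ := hT₁n ((2 : ℝ) ^ j • (v - w)) (by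
        rw [norm_smul, norm_pow, Real.norm_ofNat]
        calc (2 : ℝ) ^ j * ‖v - w‖ ≤ 2 ^ j * (1 / 2) ^ j := by gcongr
          _ = 1 := by rw [← mul_pow]; norm_num)
      refine ⟨_, Finset.mem_image_of_mem _ (Finset.mk_mem_product hw hu), ?_⟩
      have h : v - (w + ((1 / 2 : ℝ) ^ j) • u) = ((1 / 2 : ℝ) ^ j) • ((2 : ℝ) ^ j • (v - w) - u) := by
        rw [smul_sub, smul_smul, ← mul_pow]; norm_num [sub_sub]
      simp only
      rw [h, norm_smul, norm_pow, pow_succ]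
      norm_num at hvu ⊢
      exact hvu

/-- A linear map which distorts the points of an `1/8`-net by a bounded factor is bounded below. -/
theorem le_norm_of_net {F : Type*} [NormedAddCommGroup F] [NormedSpace ℝ F] (A : E →ₗ[ℝ] F)
    {T : Set E} (hT : ∀ v : E, ‖v‖ ≤ 1 → ∃ w ∈ T, ‖v - w‖ ≤ 1 / 8) {r : ℝ} (hr : 0 ≤ r)
    (hA : ∀ w ∈ T, 1 / 2 * r * ‖w‖ ≤ ‖A w‖ ∧ ‖A w‖ ≤ 2 * r * ‖w‖) (v : E) :
    1 / 10 * r * ‖v‖ ≤ ‖A v‖ := by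
  let B : E →L[ℝ] F := LinearMap.toContinuousLinearMap A
  have hB : ∀ u, ‖A u‖ ≤ ‖B‖ * ‖u‖ := fun u => B.le_opNorm u
  have hwn : ∀ u w : E, ‖u - w‖ ≤ 1 / 8 → ‖w‖ ≤ ‖u‖ + 1 / 8 ∧ ‖u‖ - 1 / 8 ≤ ‖w‖ := by
    intro u w h
    have h1 := norm_sub_norm_le u w
    have h2 := norm_sub_norm_le w u
    rw [norm_sub_rev] at h2
    constructor <;> linarith
  have hBn := norm_nonneg B
  -- Bootstrap: the operator norm is finite and reappears with factor `1/8`, so `‖B‖ ≤ 18 r / 7`.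
  -- The lower bound is then `(1/2)(7/8) r - (1/8)(18/7) r = 13 r / 112`, above `r / 10`.
  have hbound : ‖B‖ ≤ 9 / 4 * r + 1 / 8 * ‖B‖ := by
    refine ContinuousLinearMap.opNorm_le_of_unit_norm (by positivity) fun u hu => ?_
    obtain ⟨w, hw, huw⟩ := hT u hu.le
    have h1 : A u = A w + A (u - w) := by rw [map_sub]; abel
    have h2 := norm_add_le (A w) (A (u - w))
    have h3 := (hA w hw).2
    have h4 := (hB (u - w)).trans (mul_le_mul_of_nonneg_left huw hBn)
    have h5 := mul_le_mul_of_nonneg_left (hwn u w huw).1 hr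
    rw [hu] at h5
    change ‖A u‖ ≤ _
    rw [h1]
    linarith
  rcases eq_or_ne v 0 with rfl | hv
  · simp
  have hv' : 0 < ‖v‖ := norm_pos_iff.2 hv
  have hunit : ∀ u : E, ‖u‖ = 1 → 1 / 10 * r ≤ ‖A u‖ := by
    intro u hu
    obtain ⟨w, hw, huw⟩ := hT u hu.le
    have h1 : A w = A u - A (u - w) := by rw [map_sub]; abel
    have h2 := norm_sub_le (A u) (A (u - w))
    have h3 := (hA w hw).1
    have h4 := (hB (u - w)).trans (mul_le_mul_of_nonneg_left huw hBn)
    have h5 := mul_le_mul_of_nonneg_left (hwn u w huw).2 hr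
    rw [hu] at h5
    rw [h1] at h3
    linarith
  have h := hunit (‖v‖⁻¹ • v) (by rw [norm_smul, norm_inv, norm_norm, inv_mul_cancel₀ hv'.ne'])
  rw [map_smul, norm_smul, norm_inv, norm_norm, inv_mul_eq_div, le_div_iff₀ hv'] at h
  exact h

end Net

/-! ### Uniform lower bound on sparse vectors -/

/-- The vectors whose coordinates vanish outside `S`. -/
def supportedOn {N : ℕ} (S : Finset (Fin N)) : Submodule ℝ (EuclideanSpace ℝ (Fin N)) where
  carrier := {v | ∀ i ∉ S, v i = 0}
  zero_mem' := fun i _ => rfl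
  add_mem' := fun {a b} ha hb i hi => by simp [ha i hi, hb i hi]
  smul_mem' := fun c v hv i hi => by simp [hv i hi]

theorem finrank_supportedOn_le {N : ℕ} (S : Finset (Fin N)) :
    Module.finrank ℝ (supportedOn S) ≤ S.card := by
  let f : supportedOn S →ₗ[ℝ] (S → ℝ) :=
    { toFun := fun v i => v.1 i
      map_add' := fun _ _ => rfl
      map_smul' := fun _ _ => rfl }
  have hf : Function.Injective f := by
    intro v w h
    ext i
    by_cases hi : i ∈ S
    · exact congrFun h ⟨i, hi⟩
    · rw [v.2 i hi, w.2 i hi]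
  simpa using LinearMap.finrank_le_finrank_of_injective hf

theorem supportedOn_mono {N : ℕ} {S T : Finset (Fin N)} (h : S ⊆ T) :
    supportedOn S ≤ supportedOn T := fun _ hv i hi => hv i fun hi' => hi (h hi')

theorem IsSparse.exists_mem_supportedOn {N k : ℕ} (hk : k ≤ N) {z : EuclideanSpace ℝ (Fin N)}
    (hz : IsSparse k z) :
    ∃ S ∈ (Finset.univ : Finset (Fin N)).powersetCard k, z ∈ supportedOn S := by
  classical
  have hc : (Finset.univ.filter fun i => z i ≠ 0).card ≤ k := by
    rw [← Set.ncard_coe_finset]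
    simpa [IsSparse] using hz
  obtain ⟨S, hS, hSc⟩ := Finset.exists_superset_card_eq hc (by simpa using hk)
  refine ⟨S, by simpa using hSc, fun i hi => ?_⟩
  by_contra h
  exact hi (hS (by simpa using h))

/-- `Φ` is bounded below on the vectors supported on the union of two sets of size `k`. -/
def IsBoundedBelow {m N : ℕ} (k : ℕ) (Φ : Matrix (Fin m) (Fin N) ℝ) : Prop :=
  ∀ S ∈ (Finset.univ : Finset (Fin N)).powersetCard k,
    ∀ T ∈ (Finset.univ : Finset (Fin N)).powersetCard k,
      ∀ v ∈ supportedOn (S ∪ T), 1 / 10 * √m * ‖v‖ ≤ ‖Matrix.toEuclideanLin Φ v‖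

theorem gaussianMatrix_not_le_on_supportedOn {m N : ℕ} (S : Finset (Fin N)) :
    gaussianMatrix m N
        {Φ | ¬ ∀ v ∈ supportedOn S, 1 / 10 * √m * ‖v‖ ≤ ‖Matrix.toEuclideanLin Φ v‖}
      ≤ ((125 ^ S.card : ℕ) : ENNReal) * (2 * ENNReal.ofReal (Real.exp (-(m / 4)))) := by
  classical
  -- Three halvings give the radius `1/8` required by `le_norm_of_net`, and `5 ^ 3 = 125` per
  -- dimension.
  obtain ⟨T, hT, hTn⟩ := exists_pow_half_net (E := supportedOn S) 3
  have hT' : T.card ≤ 125 ^ S.card := by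
    refine hT.trans ?_
    rw [← pow_mul, mul_comm, pow_mul]
    exact Nat.pow_le_pow_right (by norm_num) (finrank_supportedOn_le S)
  have hsub : {Φ | ¬ ∀ v ∈ supportedOn S, 1 / 10 * √m * ‖v‖ ≤ ‖Matrix.toEuclideanLin Φ v‖} ⊆
      ⋃ w ∈ T, ({Φ : Matrix (Fin m) (Fin N) ℝ |
          2 * √m * ‖(w : EuclideanSpace ℝ (Fin N))‖ < ‖Matrix.toEuclideanLin Φ w‖} ∪
        {Φ | ‖Matrix.toEuclideanLin Φ (w : EuclideanSpace ℝ (Fin N))‖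
          < 1 / 2 * √m * ‖(w : EuclideanSpace ℝ (Fin N))‖}) := by
    intro Φ hΦ
    by_contra hcon
    simp only [Set.mem_iUnion, not_exists, Set.mem_union, Set.mem_ofPred_eq, not_or, not_lt] at hcon
    refine hΦ fun v hv => ?_
    exact le_norm_of_net ((Matrix.toEuclideanLin Φ).comp (supportedOn S).subtype) (T := (T : Set _))
      (fun v hv => by
        obtain ⟨w, hw, h⟩ := hTn v hv
        exact ⟨w, hw, h.trans (by norm_num)⟩) (Real.sqrt_nonneg m)
      (fun w hw => ⟨(hcon w hw).2, (hcon w hw).1⟩) ⟨v, hv⟩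
  refine (measure_mono hsub).trans ((measure_biUnion_finset_le _ _).trans ?_)
  calc _ ≤ ∑ _w ∈ T, 2 * ENNReal.ofReal (Real.exp (-(m / 4))) := by
        refine Finset.sum_le_sum fun w _ => (measure_union_le _ _).trans ?_
        rw [two_mul (ENNReal.ofReal _)]
        exact add_le_add (gaussianMatrix_norm_gt _) (gaussianMatrix_norm_lt _)
    _ ≤ _ := by
        rw [Finset.sum_const, nsmul_eq_mul]
        gcongr

theorem gaussianMatrix_not_isBoundedBelow {m N : ℕ} (k : ℕ) :
    gaussianMatrix m N {Φ | ¬ IsBoundedBelow k Φ}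
      ≤ ((N.choose k ^ 2 * 125 ^ (2 * k) : ℕ) : ENNReal)
        * (2 * ENNReal.ofReal (Real.exp (-(m / 4)))) := by
  classical
  set P := (Finset.univ : Finset (Fin N)).powersetCard k with hP
  have hsub : {Φ | ¬ IsBoundedBelow k Φ} ⊆ ⋃ p ∈ P ×ˢ P,
      {Φ : Matrix (Fin m) (Fin N) ℝ |
        ¬ ∀ v ∈ supportedOn (p.1 ∪ p.2), 1 / 10 * √m * ‖v‖ ≤ ‖Matrix.toEuclideanLin Φ v‖} := by
    intro Φ hΦ
    by_contra hcon
    simp only [Set.mem_iUnion, not_exists, Set.mem_ofPred_eq, not_not] at hcon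
    exact hΦ fun S hS T hT => hcon (S, T) (Finset.mk_mem_product hS hT)
  refine (measure_mono hsub).trans ((measure_biUnion_finset_le _ _).trans ?_)
  calc _ ≤ ∑ _p ∈ P ×ˢ P, ((125 ^ (2 * k) : ℕ) : ENNReal)
          * (2 * ENNReal.ofReal (Real.exp (-(m / 4)))) := by
        refine Finset.sum_le_sum fun p hp => (gaussianMatrix_not_le_on_supportedOn _).trans ?_
        have h1 := (Finset.mem_powersetCard.1 (Finset.mem_product.1 hp).1).2
        have h2 := (Finset.mem_powersetCard.1 (Finset.mem_product.1 hp).2).2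
        have h3 := Finset.card_union_le p.1 p.2
        gcongr
        · norm_num
        · omega
    _ = _ := by
        rw [Finset.sum_const, nsmul_eq_mul, Finset.card_product, hP, Finset.card_powersetCard]
        simp only [Finset.card_univ, Fintype.card_fin]
        push_cast
        ring

/-! ### Least squares and a measurable decoder -/

/-- The matrix of the normal equations for the least squares problem of minimizing `‖y - Φ z‖`
over the vectors `z` supported on `S`: the rows in `S` are those of `Φᵀ Φ`, the others those of
the identity. -/
def normalMatrix {m N : ℕ} (S : Finset (Fin N)) (Φ : Matrix (Fin m) (Fin N) ℝ) :
    Matrix (Fin N) (Fin N) ℝ :=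
  Matrix.of fun i j => if i ∈ S then (Φ.transpose * Φ) i j else (1 : Matrix _ _ ℝ) i j

/-- The right-hand side of the normal equations. -/
def normalVector {m N : ℕ} (S : Finset (Fin N)) (Φ : Matrix (Fin m) (Fin N) ℝ) (y : Fin m → ℝ) :
    Fin N → ℝ :=
  fun i => if i ∈ S then (Φ.transpose.mulVec y) i else 0

/-- The solution of the least squares problem of minimizing `‖y - Φ z‖` over the vectors `z`
supported on `S`. -/
noncomputable def leastSquares {m N : ℕ} (S : Finset (Fin N)) (Φ : Matrix (Fin m) (Fin N) ℝ)
    (y : Fin m → ℝ) : EuclideanSpace ℝ (Fin N) :=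
  WithLp.toLp 2 ((normalMatrix S Φ)⁻¹.mulVec (normalVector S Φ y))

instance opensMeasurableSpace_matrix (m N : ℕ) : OpensMeasurableSpace (Matrix (Fin m) (Fin N) ℝ) :=
  inferInstanceAs (OpensMeasurableSpace (Fin m → Fin N → ℝ))

theorem continuous_normalMatrix {m N : ℕ} (S : Finset (Fin N)) :
    Continuous (normalMatrix (m := m) S) := by
  refine continuous_matrix fun i j => ?_
  by_cases hi : i ∈ S
  · simp only [normalMatrix, Matrix.of_apply, hi, if_true]
    exact (continuous_id.matrix_transpose.matrix_mul continuous_id).matrix_elem i j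
  · simp only [normalMatrix, Matrix.of_apply, hi, if_false]
    exact continuous_const

theorem continuous_normalVector {m N : ℕ} (S : Finset (Fin N)) (i : Fin N) :
    Continuous fun p : Matrix (Fin m) (Fin N) ℝ × (Fin m → ℝ) => normalVector S p.1 p.2 i := by
  by_cases hi : i ∈ S
  · simp only [normalVector, hi, if_true]
    exact (continuous_apply i).comp (continuous_fst.matrix_transpose.matrix_mulVec continuous_snd)
  · simp only [normalVector, hi, if_false]
    exact continuous_const

theorem secondCountableTopology_matrix (m N : ℕ) :
    SecondCountableTopology (Matrix (Fin m) (Fin N) ℝ) :=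
  inferInstanceAs (SecondCountableTopology (Fin m → Fin N → ℝ))

theorem measurable_leastSquares {m N : ℕ} (S : Finset (Fin N)) :
    Measurable fun p : Matrix (Fin m) (Fin N) ℝ × (Fin m → ℝ) => leastSquares S p.1 p.2 := by
  have := secondCountableTopology_matrix m N
  refine (WithLp.measurable_toLp 2 _).comp (measurable_pi_lambda _ fun i => ?_)
  simp only [Matrix.mulVec, dotProduct]
  refine Finset.measurable_sum _ fun j _ => ?_
  refine Measurable.mul ?_ (continuous_normalVector S j).measurable
  have hc := continuous_normalMatrix (m := m) S
  -- The inverse is `det⁻¹` times the adjugate. Both factors come from continuous functions of `Φ`,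
  -- and real inversion is measurable even at 0, so singular matrices need no separate treatment.
  simp only [Matrix.inv_def, Ring.inverse_eq_inv', Matrix.smul_apply, smul_eq_mul]
  exact ((hc.matrix_det.measurable.inv).mul (hc.matrix_adjugate.matrix_elem i j).measurable).comp
    measurable_fst

/-- The system is nonsingular: the identity rows confine a kernel vector `u` to `S`, the other rows
then give `uᵀ Φᵀ Φ u = 0`, so `Φ u = 0` and injectivity on `S` forces `u = 0`. -/
theorem normalMatrix_mulVec_leastSquares {m N : ℕ} {S : Finset (Fin N)}
    {Φ : Matrix (Fin m) (Fin N) ℝ}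
    (hΦ : ∀ v ∈ supportedOn S, Matrix.toEuclideanLin Φ v = 0 → v = 0) (y : Fin m → ℝ) :
    (normalMatrix S Φ).mulVec (leastSquares S Φ y).ofLp = normalVector S Φ y := by
  have hdet : (normalMatrix S Φ).det ≠ 0 := by
    intro h0
    obtain ⟨u, hu, hu0⟩ := Matrix.exists_mulVec_eq_zero_iff.2 h0
    have hsupp : ∀ i ∉ S, u i = 0 := by
      intro i hi
      have := congrFun hu0 i
      simpa [normalMatrix, Matrix.mulVec, dotProduct, hi, Matrix.one_apply] using this
    have hS : ∀ i ∈ S, ((Φ.transpose * Φ).mulVec u) i = 0 := by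
      intro i hi
      have := congrFun hu0 i
      simpa [normalMatrix, Matrix.mulVec, dotProduct, hi] using this
    have h1 : u ⬝ᵥ (Φ.transpose * Φ).mulVec u = 0 := by
      refine Finset.sum_eq_zero fun i _ => ?_
      by_cases hi : i ∈ S
      · rw [hS i hi, mul_zero]
      · rw [hsupp i hi, zero_mul]
    rw [← Matrix.mulVec_mulVec, Matrix.dotProduct_mulVec, Matrix.vecMul_transpose,
      dotProduct_self_eq_zero] at h1
    have h2 := hΦ (WithLp.toLp 2 u) hsupp (by
      ext i
      exact congrFun h1 i)
    exact hu (congrArg WithLp.ofLp h2)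
  rw [leastSquares, Matrix.mulVec_mulVec, Matrix.mul_nonsing_inv _ (IsUnit.mk0 _ hdet),
    Matrix.one_mulVec]

theorem leastSquares_mem_supportedOn {m N : ℕ} {S : Finset (Fin N)}
    {Φ : Matrix (Fin m) (Fin N) ℝ}
    (hΦ : ∀ v ∈ supportedOn S, Matrix.toEuclideanLin Φ v = 0 → v = 0) (y : Fin m → ℝ) :
    leastSquares S Φ y ∈ supportedOn S := by
  intro i hi
  have := congrFun (normalMatrix_mulVec_leastSquares hΦ y) i
  simpa [normalMatrix, normalVector, Matrix.mulVec, dotProduct, hi, Matrix.one_apply] using this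

/-- The normal equations make the residual orthogonal to the image of the vectors supported on `S`;
Pythagoras does the rest. -/
theorem norm_sub_leastSquares_le {m N : ℕ} {S : Finset (Fin N)}
    {Φ : Matrix (Fin m) (Fin N) ℝ}
    (hΦ : ∀ v ∈ supportedOn S, Matrix.toEuclideanLin Φ v = 0 → v = 0) (y : Fin m → ℝ)
    {v : EuclideanSpace ℝ (Fin N)} (hv : v ∈ supportedOn S) :
    ‖WithLp.toLp 2 y - Matrix.toEuclideanLin Φ (leastSquares S Φ y)‖
      ≤ ‖WithLp.toLp 2 y - Matrix.toEuclideanLin Φ v‖ := by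
  set z := leastSquares S Φ y with hz
  have hzS : z ∈ supportedOn S := leastSquares_mem_supportedOn hΦ y
  have hnormal : ∀ i ∈ S, (Φ.transpose.mulVec (y - Φ.mulVec z.ofLp)) i = 0 := by
    intro i hi
    have h := congrFun (normalMatrix_mulVec_leastSquares hΦ y) i
    have h1 : ((normalMatrix S Φ).mulVec z.ofLp) i = ((Φ.transpose * Φ).mulVec z.ofLp) i := by
      simp [normalMatrix, Matrix.mulVec, dotProduct, hi]
    rw [← hz, h1, normalVector, if_pos hi] at h
    rw [Matrix.mulVec_sub, Matrix.mulVec_mulVec, Pi.sub_apply, h, sub_self]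
  have horth : (z.ofLp - v.ofLp) ⬝ᵥ Φ.transpose.mulVec (y - Φ.mulVec z.ofLp) = 0 := by
    refine Finset.sum_eq_zero fun i _ => ?_
    by_cases hi : i ∈ S
    · rw [hnormal i hi, mul_zero]
    · rw [Pi.sub_apply, hzS i hi, hv i hi, sub_self, zero_mul]
  rw [Matrix.dotProduct_mulVec, Matrix.vecMul_transpose, Matrix.mulVec_sub] at horth
  refine le_of_sq_le_sq ?_ (norm_nonneg _)
  rw [EuclideanSpace.real_norm_sq_eq, EuclideanSpace.real_norm_sq_eq]
  change ∑ i, (y i - Φ.mulVec z.ofLp i) ^ 2 ≤ ∑ i, (y i - Φ.mulVec v.ofLp i) ^ 2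
  have hexp : ∑ i, (y i - Φ.mulVec v.ofLp i) ^ 2 = ∑ i, (y i - Φ.mulVec z.ofLp i) ^ 2
      + ∑ i, (Φ.mulVec z.ofLp i - Φ.mulVec v.ofLp i) ^ 2
      + 2 * ∑ i, (Φ.mulVec z.ofLp i - Φ.mulVec v.ofLp i) * (y i - Φ.mulVec z.ofLp i) := by
    rw [Finset.mul_sum, ← Finset.sum_add_distrib, ← Finset.sum_add_distrib]
    exact Finset.sum_congr rfl fun i _ => by ring
  have h0 : ∑ i, (Φ.mulVec z.ofLp i - Φ.mulVec v.ofLp i) * (y i - Φ.mulVec z.ofLp i) = 0 := horth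
  have hnn : 0 ≤ ∑ i, (Φ.mulVec z.ofLp i - Φ.mulVec v.ofLp i) ^ 2 :=
    Finset.sum_nonneg fun i _ => sq_nonneg _
  linarith

theorem measurable_norm_sub_leastSquares {m N : ℕ} (S : Finset (Fin N)) :
    Measurable fun p : Matrix (Fin m) (Fin N) ℝ × (Fin m → ℝ) =>
      ‖WithLp.toLp 2 p.2 - Matrix.toEuclideanLin p.1 (leastSquares S p.1 p.2)‖ := by
  have hentry : ∀ i j, Measurable fun p : Matrix (Fin m) (Fin N) ℝ × (Fin m → ℝ) => p.1 i j :=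
    fun i j => (continuous_id.matrix_elem i j).measurable.comp measurable_fst
  refine Measurable.norm (Measurable.sub ((WithLp.measurable_toLp 2 _).comp measurable_snd) ?_)
  refine (WithLp.measurable_toLp 2 _).comp (measurable_pi_lambda _ fun i => ?_)
  change Measurable fun p : Matrix (Fin m) (Fin N) ℝ × (Fin m → ℝ) =>
    ∑ j, p.1 i j * (leastSquares S p.1 p.2).ofLp j
  exact Finset.measurable_sum _ fun j _ => (hentry i j).mul
    ((measurable_pi_apply j).comp ((WithLp.measurable_ofLp 2 _).comp (measurable_leastSquares S)))

/-- There is a measurable decoder which returns a `k`-sparse vector minimizing the residual. -/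
theorem exists_measurable_decoder {m N k : ℕ} (hk : k ≤ N) :
    ∃ dec : Matrix (Fin m) (Fin N) ℝ → (Fin m → ℝ) → EuclideanSpace ℝ (Fin N),
      Measurable (fun p : Matrix (Fin m) (Fin N) ℝ × (Fin m → ℝ) => dec p.1 p.2) ∧
      ∀ Φ, (∀ S ∈ (Finset.univ : Finset (Fin N)).powersetCard k, ∀ v ∈ supportedOn S,
          Matrix.toEuclideanLin Φ v = 0 → v = 0) → ∀ y,
        (∃ S ∈ (Finset.univ : Finset (Fin N)).powersetCard k, dec Φ y ∈ supportedOn S) ∧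
        ∀ S ∈ (Finset.univ : Finset (Fin N)).powersetCard k, ∀ v ∈ supportedOn S,
          ‖WithLp.toLp 2 y - Matrix.toEuclideanLin Φ (dec Φ y)‖
            ≤ ‖WithLp.toLp 2 y - Matrix.toEuclideanLin Φ v‖ := by
  classical
  let P := {S : Finset (Fin N) // S ∈ (Finset.univ : Finset (Fin N)).powersetCard k}
  have : Nonempty P := by
    obtain ⟨S, hS⟩ := Finset.powersetCard_nonempty.2
      (show k ≤ (Finset.univ : Finset (Fin N)).card by simpa using hk)
    exact ⟨⟨S, hS⟩⟩
  obtain ⟨e, he⟩ := exists_surjective_nat P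
  let X := Matrix (Fin m) (Fin N) ℝ × (Fin m → ℝ)
  let res : P → X → ℝ := fun S p =>
    ‖WithLp.toLp 2 p.2 - Matrix.toEuclideanLin p.1 (leastSquares S.1 p.1 p.2)‖
  have hex : ∀ p : X, ∃ n, ∀ S, res (e n) p ≤ res S p := by
    intro p
    obtain ⟨S, hS⟩ := Finite.exists_min fun S => res S p
    obtain ⟨n, rfl⟩ := he S
    exact ⟨n, hS⟩
  -- Ties are broken by the first minimizing index in an enumeration of the supports, which keeps
  -- the selection measurable.
  have hmeas : Measurable fun p : X => leastSquares (e (Nat.find (hex p))).1 p.1 p.2 := by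
    refine Measurable.find (f := fun n (p : X) => leastSquares (e n).1 p.1 p.2)
      (p := fun n p => ∀ S, res (e n) p ≤ res S p)
      (fun n => measurable_leastSquares _) (fun n => ?_) hex
    rw [Set.ofPred_forall]
    exact MeasurableSet.iInter fun S => measurableSet_le (measurable_norm_sub_leastSquares _)
      (measurable_norm_sub_leastSquares _)
  refine ⟨fun Φ y => leastSquares (e (Nat.find (hex (Φ, y)))).1 Φ y, hmeas, fun Φ hΦ y =>
    ⟨⟨_, (e (Nat.find (hex (Φ, y)))).2,
      leastSquares_mem_supportedOn (hΦ _ (e (Nat.find (hex (Φ, y)))).2) y⟩, fun S hS v hv => ?_⟩⟩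
  exact (Nat.find_spec (hex (Φ, y)) ⟨S, hS⟩).trans (norm_sub_leastSquares_le (hΦ S hS) y hv)

/-! ### Error analysis and counting -/

/-- The deterministic core. Both `xk` and `z` fit a residual to within `‖Φ (x - xk)‖`, so their
images differ by at most twice that, and the lower bound applies to `xk - z`. The constant is `10 *
2 * 2 + 1`. -/
theorem IsBoundedBelow.norm_sub_le {m N k : ℕ} (hm : 0 < m) {Φ : Matrix (Fin m) (Fin N) ℝ}
    (hΦ : IsBoundedBelow k Φ) {x xk z : EuclideanSpace ℝ (Fin N)} {S T : Finset (Fin N)}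
    (hS : S ∈ (Finset.univ : Finset (Fin N)).powersetCard k)
    (hT : T ∈ (Finset.univ : Finset (Fin N)).powersetCard k)
    (hxk : xk ∈ supportedOn S) (hz : z ∈ supportedOn T)
    (hres : ‖Matrix.toEuclideanLin Φ x - Matrix.toEuclideanLin Φ z‖
      ≤ ‖Matrix.toEuclideanLin Φ x - Matrix.toEuclideanLin Φ xk‖)
    (htail : ‖Matrix.toEuclideanLin Φ (x - xk)‖ ≤ 2 * √m * ‖x - xk‖) :
    ‖x - z‖ ≤ 41 * ‖x - xk‖ := by
  have hr : 0 < √(m : ℝ) := Real.sqrt_pos.2 (by exact_mod_cast hm)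
  have h1 := hΦ S hS T hT (xk - z) (Submodule.sub_mem _
    (supportedOn_mono Finset.subset_union_left hxk)
    (supportedOn_mono Finset.subset_union_right hz))
  rw [map_sub] at h1 htail
  have h2 := norm_sub_le_norm_sub_add_norm_sub (Matrix.toEuclideanLin Φ xk)
    (Matrix.toEuclideanLin Φ x) (Matrix.toEuclideanLin Φ z)
  rw [norm_sub_rev (Matrix.toEuclideanLin Φ xk) (Matrix.toEuclideanLin Φ x)] at h2
  have h3 : √m * ‖xk - z‖ ≤ √m * (40 * ‖x - xk‖) := by linarith
  have h4 := le_of_mul_le_mul_left h3 hr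
  have h5 := norm_sub_le_norm_sub_add_norm_sub x xk z
  linarith

/-- From `choose N k ≤ N ^ k / k! = (N/k) ^ k * (k ^ k / k!)` and `k ^ k / k! ≤ exp k`. -/
theorem choose_le_exp {N k : ℕ} (hk : 1 ≤ k) (hkN : k ≤ N) :
    (N.choose k : ℝ) ≤ Real.exp (2 * (k * max 1 (Real.log (N / k)))) := by
  have hk0 : (0 : ℝ) < k := by exact_mod_cast hk
  have hN0 : (0 : ℝ) < N := by exact_mod_cast hk.trans hkN
  calc (N.choose k : ℝ) ≤ (N : ℝ) ^ k / k.factorial := Nat.choose_le_pow_div k N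
    _ = (N / k : ℝ) ^ k * ((k : ℝ) ^ k / k.factorial) := by
        rw [div_pow]; field_simp
    _ ≤ (N / k : ℝ) ^ k * Real.exp k := by
        gcongr
        exact Real.pow_div_factorial_le_exp _ hk0.le k
    _ = Real.exp (k * Real.log (N / k) + k * 1) := by
        rw [Real.exp_add, mul_one, Real.exp_nat_mul, Real.exp_log (by positivity)]
    _ ≤ _ := by
        refine Real.exp_le_exp.2 ?_
        have h1 := mul_le_mul_of_nonneg_left (le_max_left 1 (Real.log ((N : ℝ) / k))) hk0.le
        have h2 := mul_le_mul_of_nonneg_left (le_max_right 1 (Real.log ((N : ℝ) / k))) hk0.le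
        linarith

/-- A union bound over all the bit strings of length at most `s`. -/
theorem measure_exists_list_bool_le {Ω : Type*} [MeasurableSpace Ω] (μ : Measure Ω) (s : ℕ)
    (A : List Bool → Set Ω) {c : ENNReal} (hA : ∀ b, μ (A b) ≤ c) :
    μ {ω | ∃ b : List Bool, b.length ≤ s ∧ ω ∈ A b} ≤ 2 ^ (s + 1) * c := by
  have hsub : {ω | ∃ b : List Bool, b.length ≤ s ∧ ω ∈ A b} ⊆
      ⋃ l ∈ Finset.range (s + 1), ⋃ f : Fin l → Bool, A (List.ofFn f) := by
    rintro ω ⟨b, hb, hω⟩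
    simp only [Set.mem_iUnion]
    refine ⟨b.length, Finset.mem_range.2 (by omega), b.get, ?_⟩
    rwa [List.ofFn_get]
  have hsum : ∑ l ∈ Finset.range (s + 1), 2 ^ l ≤ 2 ^ (s + 1) := by
    exact (Nat.geomSum_lt (m := 2) le_rfl fun k hk => Finset.mem_range.1 hk).le
  refine (measure_mono hsub).trans ((measure_biUnion_finset_le _ _).trans ?_)
  calc _ ≤ ∑ l ∈ Finset.range (s + 1), 2 ^ l * c := by
        refine Finset.sum_le_sum fun l _ => (measure_iUnion_fintype_le _ _).trans ?_
        refine (Finset.sum_le_sum fun f _ => hA _).trans_eq ?_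
        simp
    _ ≤ _ := by
        rw [← Finset.sum_mul]
        gcongr
        exact_mod_cast hsum

/-! ### The bounded adversary and the choice of `m` -/

/-- Gaussian matrices with least squares decoding foil every bounded adversary as soon as the
number of measurements is large enough for the two union bounds. -/
theorem exists_foils {m N k s : ℕ} (hk : k ≤ N) (hm : 0 < m) {α : ℝ} (hα : 0 < α)
    (h₁ : (N.choose k ^ 2 * 125 ^ (2 * k) : ℝ) * (2 * Real.exp (-(m / 4))) ≤ α / 2)
    (h₂ : 2 ^ (s + 1) * Real.exp (-(m / 4)) ≤ α / 2) :
    ∃ R : RandomizedRecovery m N, R.Foils k s 41 α := by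
  obtain ⟨dec, hdec, hspec⟩ := exists_measurable_decoder (m := m) hk
  refine ⟨⟨gaussianMatrix m N, inferInstance, dec, hdec⟩, ?_⟩
  rintro M ⟨M₁, M₂, hM₁, hM⟩
  choose best hbest using fun x : EuclideanSpace ℝ (Fin N) => exists_isBestSparseApprox k x
  -- For fixed `b` the vector `M₂ b - best (M₂ b)` does not depend on `Φ`, so the Gaussian tail
  -- bound applies although the adversary sees `Φ`.
  let A : List Bool → Set (Matrix (Fin m) (Fin N) ℝ) := fun b =>
    {Φ | 2 * √m * ‖M₂ b - best (M₂ b)‖ < ‖Matrix.toEuclideanLin Φ (M₂ b - best (M₂ b))‖}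
  have hA := measure_exists_list_bool_le (gaussianMatrix m N) s A
    fun b => gaussianMatrix_norm_gt (M₂ b - best (M₂ b))
  have hB := gaussianMatrix_not_isBoundedBelow (m := m) (N := N) k
  have hsub : {Φ | ¬ MeetsL2L2 k 41 (M Φ) (dec Φ (Matrix.mulVec Φ (M Φ).ofLp))} ⊆
      {Φ | ¬ IsBoundedBelow k Φ} ∪ {Φ | ∃ b : List Bool, b.length ≤ s ∧ Φ ∈ A b} := by
    intro Φ hΦ
    by_contra hcon
    simp only [Set.mem_union, Set.mem_ofPred_eq, not_or, not_not, not_exists, not_and] at hcon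
    obtain ⟨hbb, htail⟩ := hcon
    refine hΦ fun xk hxk => ?_
    have hx := hM Φ
    have ht := htail (M₁ Φ) (hM₁ Φ)
    simp only [A, Set.mem_ofPred_eq, not_lt, ← hx] at ht
    set x := M Φ
    have hinj : ∀ S ∈ (Finset.univ : Finset (Fin N)).powersetCard k, ∀ v ∈ supportedOn S,
        Matrix.toEuclideanLin Φ v = 0 → v = 0 := by
      intro S hS v hv h0
      have h := hbb S hS S hS v (by rwa [Finset.union_self])
      rw [h0, norm_zero] at h
      have hr : 0 < √(m : ℝ) := Real.sqrt_pos.2 (by exact_mod_cast hm)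
      by_contra hv0
      have := norm_pos_iff.2 hv0
      have : 0 < 1 / 10 * √m * ‖v‖ := by positivity
      linarith
    obtain ⟨⟨T, hT, hz⟩, hmin⟩ := hspec Φ hinj (Matrix.mulVec Φ x.ofLp)
    obtain ⟨S, hS, hb⟩ := (hbest x).1.exists_mem_supportedOn hk
    refine (hbb.norm_sub_le hm hS hT hb hz (hmin S hS _ hb) ht).trans ?_
    -- The tail event was set up for the chosen approximation `best x`; minimality transfers the
    -- bound to any other `xk`.
    exact mul_le_mul_of_nonneg_left ((hbest x).2 xk hxk.1) (by norm_num)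
  refine (measure_mono hsub).trans ((measure_union_le _ _).trans ?_)
  have e1 : gaussianMatrix m N {Φ | ¬ IsBoundedBelow k Φ} ≤ ENNReal.ofReal (α / 2) := by
    refine hB.trans (le_trans (le_of_eq ?_) (ENNReal.ofReal_le_ofReal h₁))
    rw [← ENNReal.ofReal_natCast, ← ENNReal.ofReal_ofNat 2, ← ENNReal.ofReal_mul (by norm_num),
      ← ENNReal.ofReal_mul (by positivity)]
    push_cast
    rfl
  have e2 : gaussianMatrix m N {Φ | ∃ b : List Bool, b.length ≤ s ∧ Φ ∈ A b}
      ≤ ENNReal.ofReal (α / 2) := by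
    refine hA.trans (le_trans (le_of_eq ?_) (ENNReal.ofReal_le_ofReal h₂))
    rw [ENNReal.ofReal_mul (by positivity), ENNReal.ofReal_pow (by norm_num), ENNReal.ofReal_ofNat]
  refine (add_le_add e1 e2).trans_eq ?_
  rw [← ENNReal.ofReal_add (by positivity) (by positivity), add_halves]

theorem mainTheorem6 :
    ∃ C K : ℝ, 0 < C ∧ 0 < K ∧ ∀ α : ℝ, 0 < α → α < 1 → ∃ K' : ℝ, 0 < K' ∧
      ∀ N k s : ℕ, 1 ≤ k → k ≤ N →
        ∃ m : ℕ,
          (m : ℝ) ≤ K' * ((k : ℝ) * max 1 (Real.log ((N : ℝ) / (k : ℝ))) + (s : ℝ) / α) ∧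
          (1 ≤ s →
            (m : ℝ) ≤ K * ((k : ℝ) * max 1 (Real.log ((N : ℝ) / (k : ℝ))) + (s : ℝ) / α)) ∧
          ∃ R : RandomizedRecovery m N, R.Foils k s C α := by
  refine ⟨41, 80, by norm_num, by norm_num, fun α hα hα1 => ⟨80 + 4 / α, by positivity,
    fun N k s hk hkN => ?_⟩⟩
  set Q : ℝ := (k : ℝ) * max 1 (Real.log ((N : ℝ) / (k : ℝ))) with hQ
  have hk1 : (1 : ℝ) ≤ k := by exact_mod_cast hk
  have hkQ : (k : ℝ) ≤ Q := le_mul_of_one_le_right (by linarith) (le_max_left _ _)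
  have hlog0 : 0 ≤ -Real.log α := by linarith [Real.log_neg hα hα1]
  have hlog1 : -Real.log α ≤ 1 / α := by
    have := Real.log_le_sub_one_of_pos (inv_pos.2 hα)
    rw [Real.log_inv] at this
    rw [one_div]
    linarith
  have hs0 : (0 : ℝ) ≤ s := Nat.cast_nonneg s
  have hsα : (s : ℝ) ≤ s / α := le_div_self hs0 hα hα1.le
  -- The two union bounds need `m / 4` at least `4 Q + 10 k + 2 log 2 + log (1/α)` and `(s + 2) log
  -- 2 + log (1/α)`; as `k ≤ Q`, this `B` covers both.
  set B : ℝ := 4 * (16 * Q + (s + 2) + -Real.log α) with hB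
  have hB0 : 0 < B := by simp only [hB]; linarith
  have hmB : B ≤ ⌈B⌉₊ := Nat.le_ceil B
  have hmB' : (⌈B⌉₊ : ℝ) < B + 1 := Nat.ceil_lt_add_one hB0.le
  have hlog2 := Real.log_two_lt_d9
  have hα2 : α / 2 = Real.exp (Real.log α - Real.log 2) := by
    rw [Real.exp_sub, Real.exp_log hα, Real.exp_log two_pos]
  refine ⟨⌈B⌉₊, ?_, fun hs => ?_, exists_foils hkN (Nat.ceil_pos.2 hB0) hα ?_ ?_⟩
  -- The term `4 log (1/α) ≤ 4 / α` is charged to `Q ≥ 1`, which makes this constant depend on `α`.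
  -- When `s ≥ 1` it is charged to `s / α` instead, and the constant becomes absolute.
  · have h1 : 4 / α ≤ 4 / α * Q := le_mul_of_one_le_right (by positivity) (by linarith)
    have h2 : 0 ≤ 4 / α * (s / α) := by positivity
    have h3 : 4 / α = 4 * (1 / α) := by ring
    linarith
  · have hs1 : (1 : ℝ) ≤ s := by exact_mod_cast hs
    have h1 : 1 / α ≤ s / α := by gcongr
    linarith
  · have h1 := choose_le_exp hk hkN
    rw [← hQ] at h1
    have h125 : (125 : ℝ) ≤ Real.exp 5 := by
      have h := Real.exp_one_gt_d9
      calc (125 : ℝ) ≤ 2.7 ^ 5 := by norm_num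
        _ ≤ Real.exp 1 ^ 5 := by gcongr; linarith
        _ = Real.exp 5 := by rw [← Real.exp_nat_mul]; norm_num
    calc _ ≤ (Real.exp (2 * Q) ^ 2 * Real.exp 5 ^ (2 * k))
          * (Real.exp (Real.log 2) * Real.exp (-(⌈B⌉₊ / 4))) := by
          rw [Real.exp_log two_pos]
          gcongr
      _ = Real.exp (4 * Q + 10 * k + Real.log 2 - ⌈B⌉₊ / 4) := by
          rw [← Real.exp_nat_mul, ← Real.exp_nat_mul, ← Real.exp_add, ← Real.exp_add,
            ← Real.exp_add]
          congr 1
          push_cast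
          ring
      _ ≤ α / 2 := by
          rw [hα2]
          refine Real.exp_le_exp.2 ?_
          linarith
  · calc _ = Real.exp (((s : ℝ) + 1) * Real.log 2 - ⌈B⌉₊ / 4) := by
          rw [sub_eq_add_neg, Real.exp_add]
          congr 1
          have := Real.exp_nat_mul (Real.log 2) (s + 1)
          push_cast at this
          rw [this, Real.exp_log two_pos]
      _ ≤ α / 2 := by
          rw [hα2]
          refine Real.exp_le_exp.2 ?_
          have h : (s : ℝ) * Real.log 2 ≤ s * 1 := by gcongr; linarith
          linarith
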